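/- **Theorem (Super-polynomial Rate).** Let $\mathcal H$ be a real Hilbert space and let $r\in\{1,2,3,\dots\}\cup\{\infty\}$. Let $\omega=\{\omega_i\}_{i=1}^r$ be weights with $\omega_i>0$ for all $i$ and $\sum_{i=1}^r\omega_i=1$, and let $M_i\neq\{0\}$ be closed linear subspaces of $\mathcal H$, $i=1,\dots,r$ (all $i\ge 1$ if $r=\infty$). Put $M:=\bigcap_{i=1}^r M_i$, write $P_L$ for the orthogonal projection onto a closed subspace $L$, and let $T_\omega(x):=\sum_{i=1}^r\omega_iP_{M_i}(x)$ for $x\in\mathcal H$. Let $\mathbf H_\omega$ be the space of all families $\mathbf x=\{x_i\}_{i=1}^r$ in $\mathcal H$ with $\sum_{i=1}^r\omega_i\|x_i\|^2<\infty$, equipped with the inner product $\langle\mathbf x,\mathbf y\rangle_\omega:=\sum_{i=1}^r\omega_i\langle x_i,y_i\rangle$, let $\mathbf C_\omega:=\{\mathbf x\in\mathbf H_\omega : x_i\in M_i \text{ for all } i\}$, let $\mathbf C_\omega^\perp$ be its orthogonal complement in $\mathbf H_\omega$, and let $A_\omega\colon\mathbf H_\omega\to\mathcal H$, $A_\omega(\mathbf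 x):=\sum_{i=1}^r\omega_ix_i$. If the set $A_\omega(\mathbf C_\omega^\perp)$ is not closed in $\mathcal H$, then $T_\omega^k$ converges super-polynomially fast to $P_M$ on some dense linear subspace $Y_\omega$ of $\mathcal H$, that is, there is a dense linear subspace $Y_\omega\subset\mathcal H$ such that $$\lim_{k\to\infty}k^n\,\|T_\omega^k(y)-P_M(y)\|=0\qquad\text{for every } y\in Y_\omega \text{ and every } n\in\mathbb N.$$ -/

import Mathlib

open Filter Topology

noncomputable section

namespace SimProj

/-- The index set `{1, …, r}` for finite `r`, and `{1, 2, 3, …}` for `r = ⊤`. -/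
abbrev Idx (r : ℕ∞) : Type := {i : ℕ // 1 ≤ i ∧ (i : ℕ∞) ≤ r}

/-- The set of weights: strictly positive families with sum `1`. -/
def Weights (ι : Type*) : Type _ := {w : ι → ℝ // (∀ i, 0 < w i) ∧ HasSum w 1}

namespace Weights

variable {ι : Type*}

instance : CoeFun (Weights ι) (fun _ => ι → ℝ) := ⟨fun w => w.1⟩

theorem pos (w : Weights ι) (i : ι) : 0 < w i := w.2.1 i

theorem hasSum (w : Weights ι) : HasSum (w : ι → ℝ) 1 := w.2.2

end Weights

variable {ι : Type*} {H : Type*} [NormedAddCommGroup H] [InnerProductSpace ℝ H]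

/-- The families `x = (x i)` in `H` with `∑ i, w i * ‖x i‖ ^ 2 < ∞`, as a subspace of all families.
For a finite index set this is every family. -/
def l2Submodule (w : Weights ι) (H : Type*) [NormedAddCommGroup H] [InnerProductSpace ℝ H] :
    Submodule ℝ (ι → H) where
  carrier := {x | Summable fun i => w i * ‖x i‖ ^ 2}
  zero_mem' := by simp [summable_zero]
  add_mem' := by
    intro x y hx hy
    refine Summable.of_nonneg_of_le (fun i => mul_nonneg (w.pos i).le (sq_nonneg _)) (fun i => ?_)
      ((Summable.add hx hy).mul_left 2)
    have h1 : ‖x i + y i‖ ^ 2 ≤ 2 * (‖x i‖ ^ 2 + ‖y i‖ ^ 2) := by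
      have := norm_add_le (x i) (y i)
      nlinarith [norm_nonneg (x i + y i), sq_nonneg (‖x i‖ - ‖y i‖)]
    have := mul_le_mul_of_nonneg_left h1 (w.pos i).le
    simp only [Pi.add_apply]
    linarith
  smul_mem' := by
    intro c x hx
    refine (Summable.mul_left (c ^ 2) hx).congr (fun i => ?_)
    simp only [Pi.smul_apply, norm_smul, mul_pow, Real.norm_eq_abs, sq_abs]
    ring

/-- The weighted product space `H_w`: finite products, or the weighted `ℓ²` space. It is a type of
its own, so that it carries only the weighted inner product defined below. -/
def WProd (w : Weights ι) (H : Type*) [NormedAddCommGroup H] [InnerProductSpace ℝ H] : Type _ :=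
  l2Submodule w H

namespace WProd

variable {w : Weights ι}

instance : AddCommGroup (WProd w H) := inferInstanceAs (AddCommGroup (l2Submodule w H))

instance : Module ℝ (WProd w H) := inferInstanceAs (Module ℝ (l2Submodule w H))

/-- The components of an element of the weighted product space. -/
def comp (x : WProd w H) : ι → H := Subtype.val x

theorem comp_ext {x y : WProd w H} (h : ∀ i, x.comp i = y.comp i) : x = y :=
  Subtype.ext (funext h)

@[simp] theorem comp_zero (i : ι) : (0 : WProd w H).comp i = 0 := rfl

@[simp] theorem comp_add (x y : WProd w H) (i : ι) : (x + y).comp i = x.comp i + y.comp i := rfl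

@[simp] theorem comp_smul (c : ℝ) (x : WProd w H) (i : ι) : (c • x).comp i = c • x.comp i := rfl

theorem summable_sq (x : WProd w H) : Summable fun i => w i * ‖x.comp i‖ ^ 2 := x.2

theorem summable_inner (x y : WProd w H) :
    Summable fun i => w i * inner ℝ (x.comp i) (y.comp i) := by
  refine Summable.of_norm_bounded (x.summable_sq.add y.summable_sq) (fun i => ?_)
  have h1 := abs_real_inner_le_norm (x.comp i) (y.comp i)
  rw [Real.norm_eq_abs, abs_mul, abs_of_pos (w.pos i), ← mul_add]
  refine mul_le_mul_of_nonneg_left ?_ (w.pos i).le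
  nlinarith [sq_nonneg (‖x.comp i‖ - ‖y.comp i‖), sq_nonneg ‖x.comp i‖, sq_nonneg ‖y.comp i‖]

/-- The weighted inner product `⟪x, y⟫ = ∑ i, w i * ⟪x i, y i⟫`. -/
@[reducible] def innerCore : InnerProductSpace.Core ℝ (WProd w H) where
  inner x y := ∑' i, w i * inner ℝ (x.comp i) (y.comp i)
  conj_inner_symm x y := by simp [real_inner_comm]
  re_inner_nonneg x := by
    simp only [RCLike.re_to_real]
    exact tsum_nonneg fun i => mul_nonneg (w.pos i).le real_inner_self_nonneg
  add_left x y z := by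
    rw [← (summable_inner x z).tsum_add (summable_inner y z)]
    exact tsum_congr fun i => by rw [comp_add, inner_add_left, mul_add]
  smul_left x y c := by
    simp only [conj_trivial]
    rw [← tsum_mul_left]
    exact tsum_congr fun i => by rw [comp_smul, real_inner_smul_left]; ring
  definite x hx := by
    refine comp_ext fun i => ?_
    have h0 := (hasSum_zero_iff_of_nonneg
      (fun i => mul_nonneg (w.pos i).le real_inner_self_nonneg)).1
      (hx ▸ (summable_inner x x).hasSum)
    have h1 : w i * inner ℝ (x.comp i) (x.comp i) = 0 := congrFun h0 i
    exact inner_self_eq_zero.1 ((mul_eq_zero.1 h1).resolve_left (w.pos i).ne')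

instance : NormedAddCommGroup (WProd w H) := innerCore.toNormedAddCommGroup

instance : InnerProductSpace ℝ (WProd w H) := InnerProductSpace.ofCore innerCore.toCore

theorem inner_def (x y : WProd w H) :
    inner ℝ x y = ∑' i, w i * inner ℝ (x.comp i) (y.comp i) := rfl

theorem summable_smul [CompleteSpace H] (x : WProd w H) : Summable fun i => w i • x.comp i := by
  refine Summable.of_norm_bounded (w.hasSum.summable.add x.summable_sq) (fun i => ?_)
  rw [norm_smul, Real.norm_eq_abs, abs_of_pos (w.pos i)]
  nlinarith [w.pos i, mul_nonneg (w.pos i).le (sq_nonneg (‖x.comp i‖ - 1)),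
    mul_nonneg (w.pos i).le (norm_nonneg (x.comp i))]

end WProd

/-- The subspace `C_w = H_w ∩ ∏ i, M i` of the weighted product space. -/
def prodSubspace (w : Weights ι) (M : ι → ClosedSubmodule ℝ H) : Submodule ℝ (WProd w H) where
  carrier := {x | ∀ i, x.comp i ∈ M i}
  zero_mem' i := (M i).toSubmodule.zero_mem
  add_mem' hx hy i := (M i).toSubmodule.add_mem (hx i) (hy i)
  smul_mem' c _ hx i := (M i).toSubmodule.smul_mem c (hx i)

/-- The averaging operator `A_w x = ∑ i, w i • x i` (the series is absolutely convergent). -/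
def averaging [CompleteSpace H] (w : Weights ι) : WProd w H →ₗ[ℝ] H where
  toFun x := ∑' i, w i • x.comp i
  map_add' x y := by
    rw [← x.summable_smul.tsum_add y.summable_smul]
    exact tsum_congr fun i => by rw [WProd.comp_add, smul_add]
  map_smul' c x := by
    rw [RingHom.id_apply, ← x.summable_smul.tsum_const_smul c]
    exact tsum_congr fun i => by rw [WProd.comp_smul, smul_comm]

/-- The simultaneous projection operator `T_w x = ∑ i, w i • P_{M i} x`
(the series is absolutely convergent). -/
def simProj [CompleteSpace H] (w : Weights ι) (M : ι → ClosedSubmodule ℝ H) (x : H) : H :=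
  ∑' i, w i • (M i).toSubmodule.starProjection x

end SimProj

end

/-! The operator `T = T_ω` is self-adjoint, satisfies `‖T v‖² ≤ ⟪T v, v⟫`, and has fixed space `M`.
Put `S = 1 - T`. Telescoping gives `‖T^k S u‖ = O(k^(-1/2))`, so a point `y 0 = S (y 1) = S² (y 2) =
⋯` with infinitely many successive preimages decays faster than every power of `k`
(`exists_pow_mul_norm_sq_le`). Such points approximate all of `Mᗮ`: since `S` is self-adjoint with
kernel `M`, it maps `Mᗮ` densely into itself, and a Mittag-Leffler argument applies
(`exists_preimage_chain`). On `M` itself `T` is the identity. -/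

namespace SimProj

/-! ### Super-polynomial decay for self-adjoint firmly nonexpansive operators -/

section FirmlyNonexpansive

variable {H : Type*} [NormedAddCommGroup H] [InnerProductSpace ℝ H]

/-- If `S` is a contraction and `S` maps `L` densely into `L`, then every point of `L` is
approximated by points with an infinite chain of preimages under `S`. -/
theorem exists_preimage_chain [CompleteSpace H] (S : H →L[ℝ] H) (hS : ∀ x, ‖S x‖ ≤ ‖x‖)
    (L : Set H) (hL : ∀ x ∈ L, ∀ ε > 0, ∃ z ∈ L, ‖S z - x‖ < ε) {x : H} (hx : x ∈ L)
    {ε : ℝ} (hε : 0 < ε) :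
    ∃ y : ℕ → H, ‖y 0 - x‖ ≤ ε ∧ ∀ n, y n = S (y (n + 1)) := by
  -- The errors `ε / 2 / 2 ^ n` add up to `ε`.
  have hstep : ∀ (n : ℕ) (z : L), ∃ z' : L, ‖S z' - z‖ < ε / 2 / 2 ^ n := fun n z => by
    obtain ⟨z', h1, h2⟩ := hL z z.2 (ε / 2 / 2 ^ n) (by positivity)
    exact ⟨⟨z', h1⟩, h2⟩
  choose f hf using hstep
  let z : ℕ → L := fun n => Nat.rec ⟨x, hx⟩ (fun n a => f n a) n
  have hz : ∀ n : ℕ, ‖S (z (n + 1)).1 - (z n).1‖ < ε / 2 / 2 ^ n := fun n => hf n (z n)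
  have hSpow : ∀ (m : ℕ) (u : H), ‖(S ^ m) u‖ ≤ ‖u‖ := by
    intro m
    induction m with
    | zero => simp
    | succ m ih => intro u; rw [pow_succ]; exact (ih _).trans (hS u)
  -- Pull the approximate chain `z` back to level `n`. Powers of `S` do not enlarge errors, so `s n`
  -- is Cauchy; `S (s (n + 1) m) = s n (m + 1)` makes the limits an exact chain.
  let s : ℕ → ℕ → H := fun n m => (S ^ m) (z (n + m)).1
  have hs : ∀ n m, dist (s n m) (s n (m + 1)) ≤ ε / 2 ^ n / 2 / 2 ^ m := by
    intro n m
    have h1 : s n (m + 1) - s n m = (S ^ m) (S (z (n + m + 1)).1 - (z (n + m)).1) := by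
      simp only [s, pow_succ, map_sub, mul_apply_eq_comp, add_assoc]
    rw [dist_comm, dist_eq_norm, h1]
    refine ((hSpow _ _).trans (hz _).le).trans (le_of_eq ?_)
    rw [pow_add]; field_simp
  have hlim : ∀ n, ∃ a, Tendsto (s n) atTop (𝓝 a) := fun n =>
    cauchySeq_tendsto_of_complete (cauchySeq_of_le_geometric_two (hs n))
  choose y hy using hlim
  refine ⟨y, ?_, fun n => ?_⟩
  · have := dist_le_of_le_geometric_two_of_tendsto₀ (hs 0) (hy 0)
    rw [← dist_eq_norm, dist_comm]
    simpa [s, z] using this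
  · have h1 : Tendsto (fun m => S (s (n + 1) m)) atTop (𝓝 (S (y (n + 1)))) :=
      (S.continuous.tendsto _).comp (hy (n + 1))
    have h2 : (fun m => S (s (n + 1) m)) = fun m => s n (m + 1) := by
      funext m
      simp only [s, pow_succ', mul_apply_eq_comp]
      rw [show n + 1 + m = n + (m + 1) by ring]
    rw [h2] at h1
    exact tendsto_nhds_unique ((tendsto_add_atTop_iff_nat 1).2 (hy n)) h1

variable {T : H →L[ℝ] H}

theorem pow_apply_comm (T : H →L[ℝ] H) (k : ℕ) (v : H) : T ((T ^ k) v) = (T ^ k) (T v) := by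
  rw [← mul_apply_eq_comp, ← pow_succ', pow_succ, mul_apply_eq_comp]

theorem norm_le_of_firm (hT : ∀ v, ‖T v‖ ^ 2 ≤ inner ℝ (T v) v) (v : H) : ‖T v‖ ≤ ‖v‖ := by
  have h1 := hT v
  have h2 := real_inner_le_norm (T v) v
  by_contra! h
  nlinarith [norm_nonneg (T v), norm_nonneg v]

theorem norm_sub_sq_le_of_firm (hT : ∀ v, ‖T v‖ ^ 2 ≤ inner ℝ (T v) v) (v : H) :
    ‖v - T v‖ ^ 2 ≤ ‖v‖ ^ 2 - ‖T v‖ ^ 2 := by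
  rw [norm_sub_sq_real, real_inner_comm]
  linarith [hT v]

theorem antitone_norm_pow_of_firm (hT : ∀ v, ‖T v‖ ^ 2 ≤ inner ℝ (T v) v) (v : H) :
    Antitone fun k : ℕ => ‖(T ^ k) v‖ :=
  antitone_nat_of_succ_le fun k => by
    rw [pow_succ']
    exact norm_le_of_firm hT _

/-- The squares `‖T^j (u - T u)‖²` are bounded by telescoping differences, so their sum over `j ≤ k`
is at most `‖u‖²`; they decrease in `j`, so each is at least the last. -/
theorem succ_mul_norm_pow_sub_sq_le (hT : ∀ v, ‖T v‖ ^ 2 ≤ inner ℝ (T v) v) (u : H) (k : ℕ) :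
    ((k : ℝ) + 1) * ‖(T ^ k) (u - T u)‖ ^ 2 ≤ ‖u‖ ^ 2 := by
  have h1 : ∀ j : ℕ, ‖(T ^ j) (u - T u)‖ ^ 2 ≤ ‖(T ^ j) u‖ ^ 2 - ‖(T ^ (j + 1)) u‖ ^ 2 := by
    intro j
    have := norm_sub_sq_le_of_firm hT ((T ^ j) u)
    rw [pow_succ T, mul_apply_eq_comp, map_sub]
    rwa [pow_apply_comm T] at this
  have h2 := Finset.sum_le_sum fun j (_ : j ∈ Finset.range (k + 1)) => h1 j
  rw [Finset.sum_range_sub' (fun j => ‖(T ^ j) u‖ ^ 2)] at h2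
  have h3 : ((Finset.range (k + 1)).card : ℝ) * ‖(T ^ k) (u - T u)‖ ^ 2 ≤
      ∑ j ∈ Finset.range (k + 1), ‖(T ^ j) (u - T u)‖ ^ 2 :=
    (nsmul_eq_mul _ _).symm.le.trans <| Finset.card_nsmul_le_sum _ _ _ fun j hj => by
      have := antitone_norm_pow_of_firm hT (u - T u) (Nat.lt_succ_iff.1 (Finset.mem_range.1 hj))
      exact pow_le_pow_left₀ (norm_nonneg _) this 2
  rw [Finset.card_range, Nat.cast_succ] at h3
  simp only [pow_zero, one_apply_eq_self] at h2
  linarith [sq_nonneg ‖(T ^ (k + 1)) u‖]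

/-- Each step up the chain gains one factor `k + 1`: half of the iterations feed the telescoping
bound, the other half the induction hypothesis at `y (n + 1)`. Hence `n` is quantified inside the
induction on `m`. -/
theorem exists_pow_mul_norm_sq_le (hT : ∀ v, ‖T v‖ ^ 2 ≤ inner ℝ (T v) v) {y : ℕ → H}
    (hy : ∀ n, y n = y (n + 1) - T (y (n + 1))) (m : ℕ) :
    ∀ n, ∃ C : ℝ, ∀ k : ℕ, ((k : ℝ) + 1) ^ m * ‖(T ^ k) (y n)‖ ^ 2 ≤ C := by
  induction m with
  | zero =>
    refine fun n => ⟨‖y n‖ ^ 2, fun k => ?_⟩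
    have := antitone_norm_pow_of_firm hT (y n) (Nat.zero_le k)
    simpa using pow_le_pow_left₀ (norm_nonneg _) this 2
  | succ m ih =>
    intro n
    obtain ⟨C, hC⟩ := ih (n + 1)
    refine ⟨2 ^ (m + 1) * C, fun k => ?_⟩
    set j := k / 2 with hj
    have hk : (k : ℝ) + 1 ≤ 2 * ((j : ℝ) + 1) := by
      have : k + 1 ≤ 2 * (j + 1) := by omega
      exact_mod_cast this
    have h1 : ‖(T ^ k) (y n)‖ ^ 2 ≤ ‖(T ^ j) ((T ^ j) (y n))‖ ^ 2 := by
      refine pow_le_pow_left₀ (norm_nonneg _) ?_ 2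
      rw [← mul_apply_eq_comp, ← pow_add]
      exact antitone_norm_pow_of_firm hT (y n) (by omega)
    have h2 : (T ^ j) (y n) = (T ^ j) (y (n + 1)) - T ((T ^ j) (y (n + 1))) := by
      rw [hy n, map_sub, pow_apply_comm]
    have h3 := succ_mul_norm_pow_sub_sq_le hT ((T ^ j) (y (n + 1))) j
    rw [← h2] at h3
    calc ((k : ℝ) + 1) ^ (m + 1) * ‖(T ^ k) (y n)‖ ^ 2
        ≤ (2 * ((j : ℝ) + 1)) ^ (m + 1) * ‖(T ^ j) ((T ^ j) (y n))‖ ^ 2 := by gcongr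
      _ = 2 ^ (m + 1) * (((j : ℝ) + 1) ^ m *
          (((j : ℝ) + 1) * ‖(T ^ j) ((T ^ j) (y n))‖ ^ 2)) := by rw [mul_pow]; ring
      _ ≤ 2 ^ (m + 1) * (((j : ℝ) + 1) ^ m * ‖(T ^ j) (y (n + 1))‖ ^ 2) := by gcongr
      _ ≤ 2 ^ (m + 1) * C := by gcongr; exact hC j

theorem tendsto_pow_mul_norm_of_chain (hT : ∀ v, ‖T v‖ ^ 2 ≤ inner ℝ (T v) v) {y : ℕ → H}
    (hy : ∀ n, y n = y (n + 1) - T (y (n + 1))) (n : ℕ) :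
    Tendsto (fun k : ℕ => (k : ℝ) ^ n * ‖(T ^ k) (y 0)‖) atTop (𝓝 0) := by
  -- The factor 2 pays for the square root; the extra power leaves `1 / (k + 1)` to force the limit.
  obtain ⟨C, hC⟩ := exists_pow_mul_norm_sq_le hT hy (2 * (n + 1)) 0
  have hlim : Tendsto (fun k : ℕ => √C * (1 / ((k : ℝ) + 1))) atTop (𝓝 0) := by
    simpa using tendsto_one_div_add_atTop_nhds_zero_nat.const_mul √C
  refine squeeze_zero (fun k => by positivity) (fun k => ?_) hlim
  have h1 : ((k : ℝ) + 1) ^ (n + 1) * ‖(T ^ k) (y 0)‖ ≤ √C := by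
    refine Real.le_sqrt_of_sq_le ((le_of_eq ?_).trans (hC k))
    ring
  rw [mul_one_div, le_div_iff₀ (by positivity)]
  refine le_trans ?_ h1
  calc (k : ℝ) ^ n * ‖(T ^ k) (y 0)‖ * (k + 1)
      ≤ ((k : ℝ) + 1) ^ n * ‖(T ^ k) (y 0)‖ * (k + 1) := by gcongr; linarith
    _ = _ := by ring

/-- The points at which the powers of `T` converge super-polynomially fast to the orthogonal
projection onto `K`. -/
def superpolySubmodule (T : H →L[ℝ] H) (K : Submodule ℝ H) [K.HasOrthogonalProjection] :
    Submodule ℝ H where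
  carrier := {y | ∀ n : ℕ,
    Tendsto (fun k : ℕ => (k : ℝ) ^ n * ‖(T ^ k) y - K.starProjection y‖) atTop (𝓝 0)}
  zero_mem' n := by simp
  add_mem' {a b} ha hb n := by
    have hab := (ha n).add (hb n)
    rw [add_zero] at hab
    refine squeeze_zero (fun k => by positivity) (fun k => ?_) hab
    rw [← mul_add, map_add, map_add, add_sub_add_comm]
    exact mul_le_mul_of_nonneg_left (norm_add_le _ _) (by positivity)
  smul_mem' c a ha n := by
    have := (ha n).const_mul |c|
    rw [mul_zero] at this
    refine this.congr fun k => ?_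
    rw [map_smul, map_smul, ← smul_sub, norm_smul, Real.norm_eq_abs]
    ring

theorem dense_superpolySubmodule [CompleteSpace H] (hsa : ∀ u v, inner ℝ (T u) v = inner ℝ u (T v))
    (hT : ∀ v, ‖T v‖ ^ 2 ≤ inner ℝ (T v) v) (K : Submodule ℝ H) [K.HasOrthogonalProjection]
    (hK : ∀ v, T v = v ↔ v ∈ K) : Dense (superpolySubmodule T K : Set H) := by
  let S : H →L[ℝ] H := 1 - T
  have hSapp : ∀ v, S v = v - T v := fun v => rfl
  have hS : ∀ v, ‖S v‖ ≤ ‖v‖ := fun v => by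
    have := norm_sub_sq_le_of_firm hT v
    rw [hSapp]
    exact abs_le_of_sq_le_sq' (by nlinarith [sq_nonneg ‖T v‖]) (norm_nonneg _) |>.2
  have hrange : ((LinearMap.range (S : H →ₗ[ℝ] H))ᗮ : Submodule ℝ H) = K := by
    ext v
    rw [← hK, Submodule.mem_orthogonal]
    constructor
    · intro h
      refine (sub_eq_zero.1 (inner_self_eq_zero (𝕜 := ℝ) |>.1 ?_)).symm
      -- By self-adjointness, `⟪S (S v), v⟫ = ‖S v‖²`.
      have h1 := h (S (v - T v)) ⟨_, rfl⟩
      rw [hSapp, inner_sub_left, hsa, ← inner_sub_right] at h1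
      exact h1
    · rintro h _ ⟨u, rfl⟩
      change inner ℝ (S u) v = 0
      rw [hSapp, inner_sub_left, hsa, h, sub_self]
  have happrox : ∀ x ∈ (Kᗮ : Set H), ∀ ε > 0, ∃ z ∈ (Kᗮ : Set H), ‖S z - x‖ < ε := by
    intro x hx ε hε
    have hx' : x ∈ (LinearMap.range (S : H →ₗ[ℝ] H)).topologicalClosure := by
      rw [← Submodule.orthogonal_orthogonal_eq_closure, hrange]
      exact hx
    obtain ⟨_, ⟨u, rfl⟩, hu⟩ := Metric.mem_closure_iff.1 hx' ε hε
    -- Removing the `K`-component of `u` leaves `S u` unchanged, because `S` vanishes on `K`.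
    refine ⟨u - K.starProjection u, Submodule.sub_starProjection_mem_orthogonal u, ?_⟩
    have h0 : S (K.starProjection u) = 0 := by
      rw [hSapp, (hK _).2 (K.starProjection_apply_mem u), sub_self]
    rw [map_sub, h0, sub_zero, ← dist_eq_norm, dist_comm]
    exact hu
  have hTpow : ∀ v ∈ K, ∀ k : ℕ, (T ^ k) v = v := by
    intro v hv k
    induction k with
    | zero => simp
    | succ k ih => rw [pow_succ, mul_apply_eq_comp, (hK v).2 hv, ih]
  rw [Metric.dense_iff]
  intro x ε hε
  obtain ⟨y, hy0, hy⟩ := exists_preimage_chain S hS (Kᗮ : Set H) happrox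
    (Submodule.sub_starProjection_mem_orthogonal (K := K) x) (half_pos hε)
  -- The limit `y 0` lies in the range of `S`, hence in `Kᗮ`.
  have hyK : y 0 ∈ Kᗮ := by
    have : y 0 ∈ (LinearMap.range (S : H →ₗ[ℝ] H))ᗮᗮ :=
      Submodule.le_orthogonal_orthogonal _ ⟨y 1, (hy 0).symm⟩
    rwa [hrange] at this
  refine ⟨y 0 + K.starProjection x, ?_, Submodule.add_mem _ ?_ ?_⟩
  · rw [Metric.mem_ball, dist_eq_norm,
      show y 0 + K.starProjection x - x = y 0 - (x - K.starProjection x) by abel]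
    linarith
  · intro n
    rw [(Submodule.starProjection_apply_eq_zero_iff _).2 hyK]
    simpa using tendsto_pow_mul_norm_of_chain hT hy n
  · intro n
    have hmem := K.starProjection_apply_mem x
    simp [hTpow _ hmem, Submodule.starProjection_eq_self_iff.2 hmem]

end FirmlyNonexpansive

/-! ### The simultaneous projection operator: self-adjointness, firmness, fixed points -/

section SimProjOperator

variable {ι : Type*} {H : Type*} [NormedAddCommGroup H] [InnerProductSpace ℝ H] [CompleteSpace H]

theorem summable_smul_starProjection (w : Weights ι) (M : ι → ClosedSubmodule ℝ H) :
    Summable fun i => w i • (M i).toSubmodule.starProjection :=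
  Summable.of_norm_bounded w.hasSum.summable fun i => by
    rw [norm_smul, Real.norm_eq_abs, abs_of_pos (w.pos i)]
    exact mul_le_of_le_one_right (w.pos i).le (Submodule.starProjection_norm_le _)

/-- The simultaneous projection operator as a continuous linear map. -/
noncomputable def simProjCLM (w : Weights ι) (M : ι → ClosedSubmodule ℝ H) : H →L[ℝ] H :=
  ∑' i, w i • (M i).toSubmodule.starProjection

theorem hasSum_simProjCLM (w : Weights ι) (M : ι → ClosedSubmodule ℝ H) (x : H) :
    HasSum (fun i => w i • (M i).toSubmodule.starProjection x) (simProjCLM w M x) :=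
  ((summable_smul_starProjection w M).hasSum).mapL (ContinuousLinearMap.apply ℝ H x)

theorem simProjCLM_apply (w : Weights ι) (M : ι → ClosedSubmodule ℝ H) (x : H) :
    simProjCLM w M x = simProj w M x :=
  (hasSum_simProjCLM w M x).tsum_eq.symm

theorem hasSum_inner_simProjCLM (w : Weights ι) (M : ι → ClosedSubmodule ℝ H) (x v : H) :
    HasSum (fun i => w i * inner ℝ ((M i).toSubmodule.starProjection x) v)
      (inner ℝ (simProjCLM w M x) v) := by
  have := (innerSL ℝ v).hasSum (hasSum_simProjCLM w M x)
  simpa [Function.comp_def, real_inner_comm, inner_smul_right] using this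

theorem inner_simProjCLM_left_eq_right (w : Weights ι) (M : ι → ClosedSubmodule ℝ H) (u v : H) :
    inner ℝ (simProjCLM w M u) v = inner ℝ u (simProjCLM w M v) := by
  refine (hasSum_inner_simProjCLM w M u v).unique ?_
  rw [real_inner_comm]
  refine (hasSum_inner_simProjCLM w M v u).congr_fun fun i => ?_
  rw [Submodule.inner_starProjection_left_eq_right, real_inner_comm]

theorem hasSum_sq_simProjCLM (w : Weights ι) (M : ι → ClosedSubmodule ℝ H) (v : H) :
    HasSum (fun i => w i * ‖(M i).toSubmodule.starProjection v‖ ^ 2)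
      (inner ℝ (simProjCLM w M v) v) := by
  refine (hasSum_inner_simProjCLM w M v v).congr_fun fun i => ?_
  have h : inner ℝ ((M i).toSubmodule.starProjection v) v =
      ‖(M i).toSubmodule.starProjection v‖ ^ 2 :=
    Submodule.re_inner_starProjection_eq_normSq (𝕜 := ℝ) _ v
  rw [h]

/-- With `t = T v`, average `⟪P_i v, t⟫ ≤ (‖P_i v‖² + ‖t‖²) / 2` over the weights and use `∑ w_i
‖P_i v‖² = ⟪T v, v⟫`. -/
theorem norm_simProjCLM_sq_le (w : Weights ι) (M : ι → ClosedSubmodule ℝ H) (v : H) :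
    ‖simProjCLM w M v‖ ^ 2 ≤ inner ℝ (simProjCLM w M v) v := by
  set t := simProjCLM w M v with ht
  have h1 := hasSum_inner_simProjCLM w M v t
  have h2 := ((hasSum_sq_simProjCLM w M v).add (w.hasSum.mul_right (‖t‖ ^ 2))).mul_left (1 / 2)
  have h3 := hasSum_le (fun i => ?_) h1 h2
  · rw [← ht, real_inner_self_eq_norm_sq] at h3
    linarith
  · have h4 := real_inner_le_norm ((M i).toSubmodule.starProjection v) t
    nlinarith [w.pos i, mul_nonneg (w.pos i).le
      (sq_nonneg (‖(M i).toSubmodule.starProjection v‖ - ‖t‖)),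
      mul_le_mul_of_nonneg_left h4 (w.pos i).le]

/-- If `T v = v`, the nonnegative terms `w_i (‖v‖² - ‖P_i v‖²)` sum to zero; positive weights then
force `‖P_i v‖ = ‖v‖`, that is `v ∈ M i`, for every `i`. -/
theorem simProjCLM_apply_eq_self_iff (w : Weights ι) (M : ι → ClosedSubmodule ℝ H) (v : H) :
    simProjCLM w M v = v ↔ v ∈ (⨅ i, M i).toSubmodule := by
  have hmem : v ∈ (⨅ i, M i).toSubmodule ↔ ∀ i, v ∈ (M i).toSubmodule := by
    simp [ClosedSubmodule.toSubmodule_iInf]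
  rw [hmem]
  constructor
  · intro h i
    have h1 := (w.hasSum.mul_right (‖v‖ ^ 2)).sub (hasSum_sq_simProjCLM w M v)
    rw [h, real_inner_self_eq_norm_sq, one_mul, sub_self] at h1
    have hle : ∀ i, ‖(M i).toSubmodule.starProjection v‖ ≤ ‖v‖ := fun i =>
      Submodule.norm_starProjection_apply_le _ v
    have h2 := (hasSum_zero_iff_of_nonneg fun i => by
      rw [← mul_sub]
      exact mul_nonneg (w.pos i).le
        (sub_nonneg.2 (pow_le_pow_left₀ (norm_nonneg _) (hle i) 2))).1 h1
    have h3 : w i * ‖v‖ ^ 2 - w i * ‖(M i).toSubmodule.starProjection v‖ ^ 2 = 0 := congrFun h2 i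
    rw [← mul_sub, mul_eq_zero, or_iff_right (w.pos i).ne', sub_eq_zero,
      sq_eq_sq₀ (norm_nonneg _) (norm_nonneg _)] at h3
    exact (Submodule.mem_iff_norm_starProjection _ v).2 h3.symm
  · intro h
    refine (hasSum_simProjCLM w M v).unique ?_
    have := w.hasSum.smul_const v
    rw [one_smul] at this
    refine this.congr_fun fun i => ?_
    rw [Submodule.starProjection_eq_self_iff.2 (h i)]

end SimProjOperator

end SimProj

theorem mainTheorem6 {H : Type*} [NormedAddCommGroup H] [InnerProductSpace ℝ H] [CompleteSpace H]
    (r : ℕ∞) (hr : 1 ≤ r) (w : SimProj.Weights (SimProj.Idx r))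
    (M : SimProj.Idx r → ClosedSubmodule ℝ H) (hM : ∀ i, M i ≠ ⊥)
    (hA : ¬ IsClosed (SimProj.averaging w '' ((SimProj.prodSubspace w M)ᗮ : Set (SimProj.WProd w H)))) :
    ∃ Y : Submodule ℝ H, Dense (Y : Set H) ∧
      ∀ y ∈ Y, ∀ n : ℕ,
        Tendsto
          (fun k : ℕ => (k : ℝ) ^ n *
            ‖(SimProj.simProj w M)^[k] y - (⨅ i, M i).toSubmodule.starProjection y‖)
          atTop (𝓝 0) := by
  refine ⟨SimProj.superpolySubmodule (SimProj.simProjCLM w M) (⨅ i, M i).toSubmodule,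
    SimProj.dense_superpolySubmodule (SimProj.inner_simProjCLM_left_eq_right w M)
      (SimProj.norm_simProjCLM_sq_le w M) _ (SimProj.simProjCLM_apply_eq_self_iff w M),
    fun y hy n => (hy n).congr fun k => ?_⟩
  have h : ⇑(SimProj.simProjCLM w M) = SimProj.simProj w M :=
    funext (SimProj.simProjCLM_apply w M)
  rw [← h, ← FunLike.coe_pow_eq_iterate]
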